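/- **Convergence of Grams.** Write $\|\cdot\|$ for the Euclidean norm. For $\mathcal L:\mathbb R^d\to\mathbb R$ that is differentiable and bounded below, put $\mathcal L^*:=\inf_w\mathcal L(w)$. The function $\mathcal L$ is *$L$-smooth* if $\|\nabla\mathcal L(x)-\nabla\mathcal L(y)\|\le L\|x-y\|$ for all $x,y\in\mathbb R^d$, and satisfies the *$\mu$-PL condition* if $\|\nabla\mathcal L(x)\|^2\ge 2\mu(\mathcal L(x)-\mathcal L^*)$ for all $x\in\mathbb R^d$. Given $w_1\in\mathbb R^d$, a step size $\eta>0$, decay rates $\beta_1,\beta_2\in[0,1)$ and $\epsilon>0$, the *Grams iterates* (without weight decay) are defined by $m_0=v_0=0$ and, for $t=1,2,\dots$, with $g_t=\nabla\mathcal L(w_t)$ and all operations coordinatewise, $$m_t=\beta_1m_{t-1}+(1-\beta_1)g_t,\qquad v_t=\beta_2v_{t-1}+(1-\beta_2)g_t^2,$$ $$u_t=\frac{m_t/(1-\beta_1^t)}{\sqrt{v_t/(1-\beta_2^t)}+\epsilon},\qquad w_{t+1}=w_t-\eta\,\mathrm{sign}(g_t)\circ|u_t|,$$ where $\mathrm{sign}(0)=0$.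 For all $L,\epsilon>0$ there is a constant $c>0$, depending only on $L$ and $\epsilon$, such that for every $C\ge c$, every $\mu>0$ and every real $G$ there is $\eta_0>0$, depending only on $L,\epsilon,C,\mu,G$, with the following property. Let $d\ge 0$, let $\mathcal L:\mathbb R^d\to\mathbb R$ be differentiable, bounded below, $L$-smooth and $\mu$-PL, let $w_1\in\mathbb R^d$, $\Delta_1:=\mathcal L(w_1)-\mathcal L^*$, and suppose that $$G\ge\max\{\epsilon,\,3\sqrt{L\Delta_1}\}.$$ Let $0<\eta\le\eta_0$, let $\beta_1,\beta_2\in[0,1)$, and suppose that $\beta:=1-\beta_1$ is of order $\Theta(\eta G^{1/2})$ in the sense that $c\,\eta\, G^{1/2}\le\beta\le C\,\eta\, G^{1/2}$. Then for every integer $T\ge 1$ the Grams iterates satisfy $$\mathcal L(w_T)-\mathcal L^*\le\frac{4G}{\mu\eta T}\bigl(\mathcal L(w_1)-\mathcal L^*\bigr).$$ -/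

import Mathlib

/-- `f` is `L`-smooth: it is differentiable and its gradient is `L`-Lipschitz in the `ℓ²` norm. -/
def IsLSmooth {d : ℕ} (L : ℝ) (f : EuclideanSpace ℝ (Fin d) → ℝ) : Prop :=
  Differentiable ℝ f ∧ ∀ x y, ‖gradient f x - gradient f y‖ ≤ L * ‖x - y‖

/-- The `μ`-Polyak–Łojasiewicz condition, with `f* = inf f` (used for `f` bounded below). -/
def IsPL {d : ℕ} (μ : ℝ) (f : EuclideanSpace ℝ (Fin d) → ℝ) : Prop :=
  ∀ x, 2 * μ * (f x - ⨅ z, f z) ≤ ‖gradient f x‖ ^ 2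

/-- State of the optimizer: weight, first moment, second moment. -/
structure GramsState (d : ℕ) where
  w : EuclideanSpace ℝ (Fin d)
  m : EuclideanSpace ℝ (Fin d)
  v : EuclideanSpace ℝ (Fin d)

/-- The bias-corrected Adam direction `u_t = m̂_t / (√v̂_t + ε)` (coordinatewise), where
`m̂_t = m_t / (1 - β₁ ^ t)` and `v̂_t = v_t / (1 - β₂ ^ t)`. -/
noncomputable def adamDirection {d : ℕ} (β₁ β₂ ε : ℝ) (t : ℕ)
    (m v : EuclideanSpace ℝ (Fin d)) : EuclideanSpace ℝ (Fin d) :=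
  WithLp.toLp 2 fun i => (m i / (1 - β₁ ^ t)) / (Real.sqrt (v i / (1 - β₂ ^ t)) + ε)

/-- The `t`-th Grams update (`t ≥ 1`), with step size `η` and gradient `g_t` of `f` at the
current weight: the moments are updated, and the weight moves by `-η • sign(g_t) ∘ |u_t|`. -/
noncomputable def gramsStep {d : ℕ} (f : EuclideanSpace ℝ (Fin d) → ℝ) (η β₁ β₂ ε : ℝ)
    (t : ℕ) (s : GramsState d) : GramsState d :=
  let g := gradient f s.w
  let m := β₁ • s.m + (1 - β₁) • g
  let v : EuclideanSpace ℝ (Fin d) :=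
    WithLp.toLp 2 fun i => β₂ * s.v i + (1 - β₂) * (g i) ^ 2
  let u := adamDirection β₁ β₂ ε t m v
  let uhat : EuclideanSpace ℝ (Fin d) := WithLp.toLp 2 fun i => Real.sign (g i) * |u i|
  ⟨s.w - η • uhat, m, v⟩

/-- The state after `k` Grams updates started at the weight `w₁` with zero moments. -/
noncomputable def gramsState {d : ℕ} (f : EuclideanSpace ℝ (Fin d) → ℝ) (η β₁ β₂ ε : ℝ)
    (w₁ : EuclideanSpace ℝ (Fin d)) : ℕ → GramsState d
  | 0 => ⟨w₁, 0, 0⟩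
  | k + 1 => gramsStep f η β₁ β₂ ε (k + 1) (gramsState f η β₁ β₂ ε w₁ k)

/-- The Grams iterate `w_t` for `t ≥ 1`: the index starts at `1`, so that `w_1 = w₁` is the
initial weight and `w_t` is obtained after `t - 1` updates. -/
noncomputable def gramsWeight {d : ℕ} (f : EuclideanSpace ℝ (Fin d) → ℝ) (η β₁ β₂ ε : ℝ)
    (w₁ : EuclideanSpace ℝ (Fin d)) (t : ℕ) : EuclideanSpace ℝ (Fin d) :=
  (gramsState f η β₁ β₂ ε w₁ (t - 1)).w

/-! The proof tracks the Lyapunov function Φ = (f - f*) + 2η/(ε(1 - β₁)) ‖m̂ - g‖², with m̂ the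
bias-corrected momentum. Since g · sign g ∘ |m̂/D| = ∑ |gᵢ||m̂ᵢ|/Dᵢ ≥ ∑ gᵢm̂ᵢ/Dᵢ, the sign
correction never hurts descent, and only the momentum error must be controlled. That error contracts
at rate at least 1 - β₁ up to the gradient drift, which is of order Lη; as 1 - β₁ ≥ 8Lη/ε, the drift
is absorbed.

With D ≤ 2G and PL, `lyapunov_step` contracts Φ by 1 - q, q = μη/(4G). The bound D ≤ 2G is
maintained in the same induction (`grams_lyapunov_bound`): Φ stays below its initial value, so ‖g‖²
≤ 2L(f - f*) ≤ G². The geometric decay is kept only in the weaker form (1 + kq)Φ ≤ Δ₁, which gives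
the 1/T rate. -/

open scoped InnerProductSpace

/-! ### Consequences of smoothness -/

/-- The quadratic upper bound of an `L`-smooth function. -/
theorem IsLSmooth.le_quadratic {d : ℕ} {L : ℝ} {f : EuclideanSpace ℝ (Fin d) → ℝ}
    (hf : IsLSmooth L f) (x p : EuclideanSpace ℝ (Fin d)) :
    f (x + p) ≤ f x + ⟪gradient f x, p⟫_ℝ + L / 2 * ‖p‖ ^ 2 := by
  have hline : ∀ s : ℝ, HasDerivAt (fun s : ℝ => x + s • p) p s := fun s => by
    simpa using ((hasDerivAt_id s).smul_const p).const_add x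
  have hderiv : ∀ s : ℝ, HasDerivAt
      (fun s : ℝ => f (x + s • p) - s * ⟪gradient f x, p⟫_ℝ - L / 2 * ‖p‖ ^ 2 * s ^ 2)
      (⟪gradient f (x + s • p), p⟫_ℝ - ⟪gradient f x, p⟫_ℝ - L * ‖p‖ ^ 2 * s) s := by
    intro s
    have h1 : HasDerivAt (fun s : ℝ => f (x + s • p)) ⟪gradient f (x + s • p), p⟫_ℝ s := by
      have h := (hf.1 (x + s • p)).hasGradientAt.hasFDerivAt.comp_hasDerivAt s (hline s)
      rw [InnerProductSpace.toDual_apply_apply] at h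
      exact h
    have h2 := (hasDerivAt_id s).mul_const ⟪gradient f x, p⟫_ℝ
    have h3 := (hasDerivAt_pow 2 s).const_mul (L / 2 * ‖p‖ ^ 2)
    refine ((h1.sub h2).sub h3).congr_deriv ?_
    simp
    ring
  have hanti := antitoneOn_of_deriv_nonpos (convex_Icc (0 : ℝ) 1)
    (fun s _ => (hderiv s).continuousAt.continuousWithinAt)
    (fun s _ => (hderiv s).differentiableAt.differentiableWithinAt)
    (fun s hs => by
      rw [interior_Icc] at hs
      rw [(hderiv s).deriv, ← inner_sub_left]
      have h1 := real_inner_le_norm (gradient f (x + s • p) - gradient f x) p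
      have h2 := hf.2 (x + s • p) x
      rw [add_sub_cancel_left, norm_smul, Real.norm_of_nonneg hs.1.le] at h2
      have h3 := mul_le_mul_of_nonneg_right h2 (norm_nonneg p)
      nlinarith)
  have := hanti (Set.left_mem_Icc.2 zero_le_one) (Set.right_mem_Icc.2 zero_le_one) zero_le_one
  simp only [one_smul, zero_smul, add_zero] at this
  linarith

/-- A gradient step of length 1/L lowers `f` by at least ‖∇f‖²/(2L), yet cannot go below the
infimum. -/
theorem IsLSmooth.norm_gradient_sq_le {d : ℕ} {L : ℝ} {f : EuclideanSpace ℝ (Fin d) → ℝ}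
    (hL : 0 < L) (hf : IsLSmooth L f) (hb : BddBelow (Set.range f))
    (x : EuclideanSpace ℝ (Fin d)) :
    ‖gradient f x‖ ^ 2 ≤ 2 * L * (f x - ⨅ z, f z) := by
  have h1 := hf.le_quadratic x (-(1 / L) • gradient f x)
  have h2 := ciInf_le hb (x + -(1 / L) • gradient f x)
  rw [inner_smul_right, real_inner_self_eq_norm_sq, norm_smul, mul_pow, Real.norm_eq_abs,
    sq_abs] at h1
  have h3 : -(1 / L) * ‖gradient f x‖ ^ 2 + L / 2 * ((-(1 / L)) ^ 2 * ‖gradient f x‖ ^ 2)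
      = -(‖gradient f x‖ ^ 2 / (2 * L)) := by
    field_simp
    ring
  have h4 : ‖gradient f x‖ ^ 2 / (2 * L) ≤ f x - ⨅ z, f z := by linarith
  rw [div_le_iff₀ (by positivity)] at h4
  linarith

/-! ### Sign-corrected directions in the weighted norm -/

theorem mul_sign_mul_eq_abs_mul (a b : ℝ) : a * (Real.sign a * b) = |a| * b := by
  rw [← mul_assoc]
  rcases lt_trichotomy a 0 with h | h | h
  · rw [Real.sign_of_neg h, abs_of_neg h]; ring
  · simp [h]
  · rw [Real.sign_of_pos h, abs_of_pos h]; ring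

theorem sign_sq_le_one (a : ℝ) : Real.sign a ^ 2 ≤ 1 := by
  rcases Real.sign_apply_eq a with h | h | h <;> rw [h] <;> norm_num

/-- The weighted squared norm `∑ gᵢ² / Dᵢ`. -/
noncomputable def weightedSq {d : ℕ} (D : Fin d → ℝ) (g : EuclideanSpace ℝ (Fin d)) : ℝ :=
  ∑ i, g i ^ 2 / D i

theorem weightedSq_le {d : ℕ} {D : Fin d → ℝ} {ε : ℝ} (hε : 0 < ε) (hD : ∀ i, ε ≤ D i)
    (g : EuclideanSpace ℝ (Fin d)) : weightedSq D g ≤ ‖g‖ ^ 2 / ε := by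
  rw [EuclideanSpace.real_norm_sq_eq, Finset.sum_div, weightedSq]
  exact Finset.sum_le_sum fun i _ => div_le_div_of_nonneg_left (sq_nonneg _) hε (hD i)

theorem le_weightedSq {d : ℕ} {D : Fin d → ℝ} {M : ℝ} (hD : ∀ i, 0 < D i) (hM : ∀ i, D i ≤ M)
    (g : EuclideanSpace ℝ (Fin d)) : ‖g‖ ^ 2 / M ≤ weightedSq D g := by
  rw [EuclideanSpace.real_norm_sq_eq, Finset.sum_div, weightedSq]
  exact Finset.sum_le_sum fun i _ => div_le_div_of_nonneg_left (sq_nonneg _) (hD i) (hM i)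

/-- The sign-corrected direction `sign g ∘ |m / D|`. -/
noncomputable def signedDirection {d : ℕ} (D : Fin d → ℝ) (g m : EuclideanSpace ℝ (Fin d)) :
    EuclideanSpace ℝ (Fin d) :=
  WithLp.toLp 2 fun i => Real.sign (g i) * |m i / D i|

theorem le_inner_signedDirection {d : ℕ} {D : Fin d → ℝ} (hD : ∀ i, 0 < D i)
    (g m : EuclideanSpace ℝ (Fin d)) :
    weightedSq D g / 2 - weightedSq D (m - g) / 2 ≤ ⟪g, signedDirection D g m⟫_ℝ := by
  rw [weightedSq, weightedSq, PiLp.inner_apply, Finset.sum_div, Finset.sum_div,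
    ← Finset.sum_sub_distrib]
  refine Finset.sum_le_sum fun i _ => ?_
  -- Polarization: gm = (g² + m² - (m - g)²)/2, with m² dropped.
  have key : g i ^ 2 / 2 - (m i - g i) ^ 2 / 2 ≤ |g i| * |m i| := by
    rw [← abs_mul]
    nlinarith [le_abs_self (g i * m i), sq_nonneg (m i)]
  have h := div_le_div_of_nonneg_right key (hD i).le
  have e : inner ℝ (g i) (signedDirection D g m i) = |g i| * |m i| / D i := by
    rw [signedDirection, real_inner_comm]
    change g i * (Real.sign (g i) * |m i / D i|) = _
    rw [mul_sign_mul_eq_abs_mul, abs_div, abs_of_pos (hD i), mul_div_assoc]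
  rw [e]
  refine le_trans (le_of_eq ?_) h
  simp only [PiLp.sub_apply]
  ring

theorem norm_signedDirection_sq_le {d : ℕ} {D : Fin d → ℝ} {ε : ℝ} (hε : 0 < ε)
    (hD : ∀ i, ε ≤ D i) (g m : EuclideanSpace ℝ (Fin d)) :
    ‖signedDirection D g m‖ ^ 2 ≤ 2 / ε * (weightedSq D g + weightedSq D (m - g)) := by
  rw [EuclideanSpace.real_norm_sq_eq, weightedSq, weightedSq, ← Finset.sum_add_distrib,
    Finset.mul_sum]
  refine Finset.sum_le_sum fun i _ => ?_
  have hDi : 0 < D i := hε.trans_le (hD i)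
  have h1 : signedDirection D g m i ^ 2 ≤ m i ^ 2 / D i ^ 2 := by
    change (Real.sign (g i) * |m i / D i|) ^ 2 ≤ _
    rw [mul_pow, sq_abs, div_pow]
    exact mul_le_of_le_one_left (by positivity) (sign_sq_le_one _)
  have h2 : m i ^ 2 / D i ^ 2 ≤ m i ^ 2 / (ε * D i) := by
    apply div_le_div_of_nonneg_left (sq_nonneg _) (by positivity)
    rw [sq]
    exact mul_le_mul_of_nonneg_right (hD i) hDi.le
  have h3 : m i ^ 2 / (ε * D i) ≤ (2 * (g i ^ 2 + (m i - g i) ^ 2)) / (ε * D i) := by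
    apply div_le_div_of_nonneg_right _ (by positivity)
    nlinarith [sq_nonneg (m i - 2 * g i)]
  refine h1.trans (h2.trans (h3.trans (le_of_eq ?_)))
  simp only [PiLp.sub_apply]
  field_simp

/-! ### One step of the Lyapunov function -/

/-- Contraction of the momentum error, up to the drift `p` of the gradient. -/
theorem norm_smul_add_sq_le {V : Type*} [NormedAddCommGroup V] [InnerProductSpace ℝ V]
    {a b : ℝ} (hb : 0 < b) (hba : b ≤ a) (ha : a ≤ 1) (e p : V) :
    ‖(1 - a) • (e + p)‖ ^ 2 ≤ (1 - b) * ‖e‖ ^ 2 + ‖p‖ ^ 2 / b := by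
  have ha0 : 0 < a := hb.trans_le hba
  rw [norm_smul, mul_pow, Real.norm_eq_abs, sq_abs]
  -- Young's inequality with the actual weight `a`; the uniform lower bound `b` enters only at the
  -- end.
  have h1 : ‖e + p‖ ^ 2 ≤ (1 + a) * ‖e‖ ^ 2 + (1 + 1 / a) * ‖p‖ ^ 2 := by
    have h2 : 2 * (‖e‖ * ‖p‖) ≤ a * ‖e‖ ^ 2 + 1 / a * ‖p‖ ^ 2 := by
      have h3 : a * ‖e‖ ^ 2 + 1 / a * ‖p‖ ^ 2 - 2 * (‖e‖ * ‖p‖) = (a * ‖e‖ - ‖p‖) ^ 2 / a := by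
        field_simp
        ring
      have : 0 ≤ (a * ‖e‖ - ‖p‖) ^ 2 / a := by positivity
      linarith
    nlinarith [norm_add_le e p, norm_nonneg (e + p), norm_nonneg e, norm_nonneg p]
  have h4 : (1 - a) ^ 2 * (1 + a) ≤ 1 - b := by
    have : (1 - a) ^ 2 * (1 + a) ≤ 1 - a := by
      nlinarith [mul_nonneg (sub_nonneg.2 ha) (sq_nonneg a)]
    linarith
  have h5 : (1 - a) ^ 2 * (1 + 1 / a) ≤ 1 / b := by
    have h6 : (1 - a) ^ 2 * (1 + 1 / a) ≤ 1 / a := by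
      rw [show (1 - a) ^ 2 * (1 + 1 / a) = ((1 - a) ^ 2 * (1 + a)) / a by field_simp; ring]
      exact div_le_div_of_nonneg_right (by linarith) ha0.le
    exact h6.trans (one_div_le_one_div_of_le hb hba)
  calc (1 - a) ^ 2 * ‖e + p‖ ^ 2
      ≤ (1 - a) ^ 2 * ((1 + a) * ‖e‖ ^ 2 + (1 + 1 / a) * ‖p‖ ^ 2) :=
        mul_le_mul_of_nonneg_left h1 (sq_nonneg _)
    _ = ((1 - a) ^ 2 * (1 + a)) * ‖e‖ ^ 2 + ((1 - a) ^ 2 * (1 + 1 / a)) * ‖p‖ ^ 2 := by ring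
    _ ≤ (1 - b) * ‖e‖ ^ 2 + 1 / b * ‖p‖ ^ 2 := by gcongr
    _ = _ := by ring

/-- One step of the sign-corrected method decreases `f` plus a multiple of the squared
momentum error. -/
theorem lyapunov_step {d : ℕ} {L ε η b a G μ : ℝ} {f : EuclideanSpace ℝ (Fin d) → ℝ}
    (hL : 0 < L) (hε : 0 < ε) (hη : 0 < η) (hηL : 8 * (L * η) ≤ ε) (hf : IsLSmooth L f)
    (hPL : IsPL μ f) (hμL : μ ≤ L)
    (hG : ε ≤ G) (hb : 8 * L * η ≤ ε * b) (hba : b ≤ a) (ha : a ≤ 1)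
    {D : Fin d → ℝ} (hD : ∀ i, ε ≤ D i) (hDG : ∀ i, D i ≤ 2 * G)
    {x y m e' : EuclideanSpace ℝ (Fin d)}
    (hy : y = x - η • signedDirection D (gradient f x) m)
    (he' : e' = (1 - a) • (m - gradient f y)) :
    (f y - ⨅ z, f z) + 2 * η / (ε * b) * ‖e'‖ ^ 2 ≤
      (1 - μ * η / (4 * G)) *
        ((f x - ⨅ z, f z) + 2 * η / (ε * b) * ‖m - gradient f x‖ ^ 2) := by
  set g := gradient f x with hg
  set S := weightedSq D g with hS
  set E := ‖m - g‖ ^ 2 with hE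
  set U := ‖signedDirection D g m‖ ^ 2 with hU
  have hb0 : 0 < b := by
    have : 0 < ε * b := lt_of_lt_of_le (by positivity) hb
    exact pos_of_mul_pos_right this hε.le
  have hG0 : 0 < G := hε.trans_le hG
  have hD0 : ∀ i, 0 < D i := fun i => hε.trans_le (hD i)
  have hE0 : 0 ≤ E := sq_nonneg _
  have hS0 : 0 ≤ S := Finset.sum_nonneg fun i _ => div_nonneg (sq_nonneg _) (hD0 i).le
  have hWE : weightedSq D (m - g) ≤ E / ε := weightedSq_le hε hD _
  have hUb : U ≤ 2 / ε * (S + E / ε) :=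
    (norm_signedDirection_sq_le hε hD g m).trans (by gcongr)
  have hUε : ε * U ≤ 2 * (S + E / ε) := by
    calc ε * U ≤ ε * (2 / ε * (S + E / ε)) := by gcongr
      _ = _ := by field_simp
  have hdescent : f y ≤ f x - η * (3 / 8 * S) + η * (5 / 8 * (E / ε)) := by
    have h1 := hf.le_quadratic x (-(η • signedDirection D g m))
    rw [← sub_eq_add_neg, ← hy, inner_neg_right, inner_smul_right, norm_neg, norm_smul, mul_pow,
      Real.norm_of_nonneg hη.le] at h1
    have h2 := le_inner_signedDirection hD0 g m
    have h3 : L / 2 * (η ^ 2 * U) ≤ η * (1 / 8 * (S + E / ε)) := by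
      have : 8 * (L * η) * U ≤ ε * U := mul_le_mul_of_nonneg_right hηL (sq_nonneg _)
      have := mul_le_mul_of_nonneg_left (this.trans hUε) hη.le
      linear_combination this / 16
    have h4 : η * (S / 2 - E / ε / 2) ≤ η * ⟪g, signedDirection D g m⟫_ℝ := by
      apply mul_le_mul_of_nonneg_left _ hη.le
      linarith
    linear_combination h1 + h3 + h4
  have herr : ‖e'‖ ^ 2 ≤ (1 - b) * E + L ^ 2 * η ^ 2 * U / b := by
    have h1 : e' = (1 - a) • ((m - g) + (g - gradient f y)) := by
      rw [he']; congr 1; abel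
    rw [h1]
    refine (norm_smul_add_sq_le hb0 hba ha _ _).trans ?_
    gcongr
    have h2 := hf.2 x y
    have h3 : x - y = η • signedDirection D g m := by rw [hy]; abel
    rw [h3, norm_smul, Real.norm_of_nonneg hη.le] at h2
    calc ‖g - gradient f y‖ ^ 2 ≤ (L * (η * ‖signedDirection D g m‖)) ^ 2 := by gcongr
      _ = L ^ 2 * η ^ 2 * U := by rw [hU]; ring
  have hr : L ^ 2 * η ^ 2 * U / b ≤ b * ε / 32 * (S + E / ε) := by
    rw [div_le_iff₀ hb0]
    have h1 : 64 * (L ^ 2 * η ^ 2) ≤ ε ^ 2 * b ^ 2 := by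
      have := pow_le_pow_left₀ (by positivity) hb 2
      linear_combination this
    have h2 := mul_le_mul_of_nonneg_right h1 (sq_nonneg ‖signedDirection D g m‖)
    have h3 : ε * b ^ 2 * (ε * U) ≤ ε * b ^ 2 * (2 * (S + E / ε)) := by gcongr
    linear_combination (h2 + h3) / 64
  have hA : 2 * η / (ε * b) * ‖e'‖ ^ 2 ≤
      2 * η / (ε * b) * ((1 - b) * E) + η / 16 * (S + E / ε) := by
    calc 2 * η / (ε * b) * ‖e'‖ ^ 2
        ≤ 2 * η / (ε * b) * ((1 - b) * E + b * ε / 32 * (S + E / ε)) := by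
          gcongr; linarith
      _ = _ := by field_simp; ring
  have hPLx : μ * η / (4 * G) * (f x - ⨅ z, f z) ≤ η * (5 / 16 * S) := by
    have h1 := (div_le_div_of_nonneg_right (hPL x) (by positivity : 0 ≤ 2 * G)).trans
      (le_weightedSq hD0 hDG g)
    have h2 : μ * η / (4 * G) * (f x - ⨅ z, f z)
        = η / 4 * (2 * μ * (f x - ⨅ z, f z) / (2 * G)) := by
      field_simp
    rw [h2]
    have h3 := mul_le_mul_of_nonneg_left h1 (by positivity : 0 ≤ η / 4)
    linear_combination h3 + mul_nonneg hη.le hS0 / 16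
  have hrate : μ * η / (4 * G) ≤ b / 2 := by
    rw [div_le_div_iff₀ (by positivity) (by positivity)]
    have h1 : μ * η ≤ L * η := by gcongr
    have h2 : ε * b ≤ G * b := by gcongr
    linear_combination 2 * h1 + hb / 4 + h2 / 4 + 15 / 4 * (mul_pos hb0 hG0).le
  have hAE : 2 * η / (ε * b) * (b * E) = 2 * η * (E / ε) := by field_simp
  have hEr : μ * η / (4 * G) * (2 * η / (ε * b) * E) ≤ η * (E / ε) := by
    calc _ ≤ b / 2 * (2 * η / (ε * b) * E) := by gcongr
      _ = _ := by field_simp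
  have hEε : 0 ≤ η * (E / ε) := by positivity
  -- Budget: contraction frees 2ηE/ε, against 5/8 (descent), 1/16 (drift) and 1 (the rate on the
  -- error term), leaving 5/16. Of S, 3/8 - 1/16 = 5/16 remains for PL.
  linear_combination hdescent + hA + hPLx + hEr - hAE + 5 / 16 * hEε

/-! ### The Grams iterates -/

section Iterates

variable {d : ℕ} (f : EuclideanSpace ℝ (Fin d) → ℝ) (η β₁ β₂ ε : ℝ)
  (w₁ : EuclideanSpace ℝ (Fin d))

/-- The bias-corrected first moment used in update `k + 1`. -/
noncomputable def momentHat (k : ℕ) : EuclideanSpace ℝ (Fin d) :=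
  (1 / (1 - β₁ ^ (k + 1))) • (gramsState f η β₁ β₂ ε w₁ (k + 1)).m

/-- The denominators in update `k + 1`. -/
noncomputable def adamDenominator (k : ℕ) (i : Fin d) : ℝ :=
  Real.sqrt ((gramsState f η β₁ β₂ ε w₁ (k + 1)).v i / (1 - β₂ ^ (k + 1))) + ε

theorem gramsState_succ_w (k : ℕ) :
    (gramsState f η β₁ β₂ ε w₁ (k + 1)).w = (gramsState f η β₁ β₂ ε w₁ k).w -
      η • signedDirection (adamDenominator f η β₁ β₂ ε w₁ k)
        (gradient f (gramsState f η β₁ β₂ ε w₁ k).w) (momentHat f η β₁ β₂ ε w₁ k) := by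
  have h : ∀ i, momentHat f η β₁ β₂ ε w₁ k i
      = (gramsState f η β₁ β₂ ε w₁ (k + 1)).m i / (1 - β₁ ^ (k + 1)) := fun i => by
    rw [momentHat, PiLp.smul_apply, smul_eq_mul]
    ring
  unfold signedDirection
  simp only [h]
  rfl

theorem gramsState_succ_m (k : ℕ) :
    (gramsState f η β₁ β₂ ε w₁ (k + 1)).m = β₁ • (gramsState f η β₁ β₂ ε w₁ k).m +
      (1 - β₁) • gradient f (gramsState f η β₁ β₂ ε w₁ k).w := rfl

theorem gramsState_succ_v (k : ℕ) (i : Fin d) :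
    (gramsState f η β₁ β₂ ε w₁ (k + 1)).v i = β₂ * (gramsState f η β₁ β₂ ε w₁ k).v i +
      (1 - β₂) * (gradient f (gramsState f η β₁ β₂ ε w₁ k).w i) ^ 2 := rfl

variable {f η β₁ β₂ ε w₁}

theorem momentHat_zero (h1 : β₁ < 1) : momentHat f η β₁ β₂ ε w₁ 0 = gradient f w₁ := by
  rw [momentHat, gramsState_succ_m]
  have : 1 - β₁ ≠ 0 := by linarith
  simp [gramsState, smul_smul, this]

/-- Bias correction makes m̂ a convex combination of its predecessor and the new gradient; the
latter's weight lies between 1 - β₁ and 1. -/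
theorem momentHat_succ_sub (h0 : 0 ≤ β₁) (h1 : β₁ < 1) (k : ℕ) :
    momentHat f η β₁ β₂ ε w₁ (k + 1) - gradient f (gramsState f η β₁ β₂ ε w₁ (k + 1)).w =
      (1 - (1 - β₁) / (1 - β₁ ^ (k + 2))) • (momentHat f η β₁ β₂ ε w₁ k -
        gradient f (gramsState f η β₁ β₂ ε w₁ (k + 1)).w) := by
  have hk : 1 - β₁ ^ (k + 1) ≠ 0 := (sub_pos.2 (pow_lt_one₀ h0 h1 (by omega))).ne'
  have hk' : 1 - β₁ ^ (k + 2) ≠ 0 := (sub_pos.2 (pow_lt_one₀ h0 h1 (by omega))).ne'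
  rw [momentHat, momentHat, gramsState_succ_m _ _ _ _ _ _ (k + 1)]
  ext i
  simp only [PiLp.sub_apply, PiLp.smul_apply, PiLp.add_apply, smul_eq_mul]
  rw [show k + 1 + 1 = k + 2 from rfl]
  field_simp
  ring

theorem gramsState_v_nonneg (h0 : 0 ≤ β₂) (h1 : β₂ < 1) (k : ℕ) (i : Fin d) :
    0 ≤ (gramsState f η β₁ β₂ ε w₁ k).v i := by
  induction k with
  | zero => simp [gramsState]
  | succ k ih =>
    rw [gramsState_succ_v]
    have := sub_pos.2 h1
    positivity

theorem gramsState_succ_v_le {G : ℝ} (h0 : 0 ≤ β₂) (h1 : β₂ < 1) {k : ℕ} {i : Fin d}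
    (hv : (gramsState f η β₁ β₂ ε w₁ k).v i ≤ (1 - β₂ ^ k) * G ^ 2)
    (hg : (gradient f (gramsState f η β₁ β₂ ε w₁ k).w i) ^ 2 ≤ G ^ 2) :
    (gramsState f η β₁ β₂ ε w₁ (k + 1)).v i ≤ (1 - β₂ ^ (k + 1)) * G ^ 2 := by
  rw [gramsState_succ_v, pow_succ β₂]
  have h2 := mul_le_mul_of_nonneg_left hv h0
  have h3 := mul_le_mul_of_nonneg_left hg (sub_pos.2 h1).le
  linarith

theorem adamDenominator_le {G : ℝ} (hG0 : 0 ≤ G) (hG : ε ≤ G) (h0 : 0 ≤ β₂) (h1 : β₂ < 1)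
    {k : ℕ} {i : Fin d}
    (hv : (gramsState f η β₁ β₂ ε w₁ (k + 1)).v i ≤ (1 - β₂ ^ (k + 1)) * G ^ 2) :
    adamDenominator f η β₁ β₂ ε w₁ k i ≤ 2 * G := by
  have hk : 0 < 1 - β₂ ^ (k + 1) := sub_pos.2 (pow_lt_one₀ h0 h1 (by omega))
  have : Real.sqrt ((gramsState f η β₁ β₂ ε w₁ (k + 1)).v i / (1 - β₂ ^ (k + 1))) ≤ G := by
    rw [Real.sqrt_le_left hG0, div_le_iff₀ hk]
    linarith
  rw [adamDenominator]
  linarith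

/-- Decay of the Lyapunov function along the Grams iterates. -/
theorem grams_lyapunov_bound {L μ G : ℝ} (hL : 0 < L) (hμ : 0 < μ) (hε : 0 < ε) (hη : 0 < η)
    (hηL : 8 * (L * η) ≤ ε) (hf : IsLSmooth L f) (hb : BddBelow (Set.range f))
    (hPL : IsPL μ f) (hμL : μ ≤ L) (hG : ε ≤ G) (hGΔ : 2 * L * (f w₁ - ⨅ z, f z) ≤ G ^ 2)
    (h0 : 0 ≤ β₁) (h1 : β₁ < 1) (h0' : 0 ≤ β₂) (h1' : β₂ < 1)
    (hβ : 8 * L * η ≤ ε * (1 - β₁)) (k : ℕ) :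
    (1 + k * (μ * η / (4 * G))) * ((f (gramsState f η β₁ β₂ ε w₁ k).w - ⨅ z, f z) +
      2 * η / (ε * (1 - β₁)) * ‖momentHat f η β₁ β₂ ε w₁ k -
        gradient f (gramsState f η β₁ β₂ ε w₁ k).w‖ ^ 2) ≤ f w₁ - ⨅ z, f z ∧
    ∀ i, (gramsState f η β₁ β₂ ε w₁ k).v i ≤ (1 - β₂ ^ k) * G ^ 2 := by
  have hΔ : ∀ x, 0 ≤ f x - ⨅ z, f z := fun x => sub_nonneg.2 (ciInf_le hb x)
  have hG0 : 0 < G := hε.trans_le hG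
  have hβ0 : 0 < 1 - β₁ := sub_pos.2 h1
  induction k with
  -- The first corrected momentum equals the gradient, so the error term starts at 0.
  | zero => simp [momentHat_zero h1, gramsState]
  | succ k ih =>
    obtain ⟨ih, ihv⟩ := ih
    set q := μ * η / (4 * G) with hq
    have hq0 : 0 < q := by positivity
    set Φ := (f (gramsState f η β₁ β₂ ε w₁ k).w - ⨅ z, f z) +
      2 * η / (ε * (1 - β₁)) * ‖momentHat f η β₁ β₂ ε w₁ k -
        gradient f (gramsState f η β₁ β₂ ε w₁ k).w‖ ^ 2 with hΦ
    have hΦΔ : f (gramsState f η β₁ β₂ ε w₁ k).w - ⨅ z, f z ≤ Φ :=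
      le_add_of_nonneg_right (by positivity)
    have hΦ0 : 0 ≤ Φ := (hΔ _).trans hΦΔ
    have hΦ1 : Φ ≤ f w₁ - ⨅ z, f z :=
      (le_mul_of_one_le_left hΦ0 (le_add_of_nonneg_right (by positivity))).trans ih
    have hgrad : ‖gradient f (gramsState f η β₁ β₂ ε w₁ k).w‖ ^ 2 ≤ G ^ 2 := by
      refine (hf.norm_gradient_sq_le hL hb _).trans (le_trans ?_ hGΔ)
      exact mul_le_mul_of_nonneg_left (hΦΔ.trans hΦ1) (by positivity)
    have hv : ∀ i, (gramsState f η β₁ β₂ ε w₁ (k + 1)).v i ≤ (1 - β₂ ^ (k + 1)) * G ^ 2 := by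
      refine fun i => gramsState_succ_v_le h0' h1' (ihv i) (le_trans ?_ hgrad)
      rw [EuclideanSpace.real_norm_sq_eq]
      exact Finset.single_le_sum
        (f := fun i => (gradient f (gramsState f η β₁ β₂ ε w₁ k).w i) ^ 2)
        (fun j _ => sq_nonneg _) (Finset.mem_univ i)
    refine ⟨?_, hv⟩
    have hk : 0 < 1 - β₁ ^ (k + 2) := sub_pos.2 (pow_lt_one₀ h0 h1 (by omega))
    have hstep := lyapunov_step (a := (1 - β₁) / (1 - β₁ ^ (k + 2))) hL hε hη hηL hf hPL hμL
      hG hβ (le_div_self hβ0.le hk (by linarith [pow_nonneg h0 (k + 2)]))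
      (div_le_one_of_le₀ (by linarith [pow_le_of_le_one h0 h1.le (by omega : k + 2 ≠ 0)]) hk.le)
      (fun i => le_add_of_nonneg_left (Real.sqrt_nonneg _))
      (fun i => adamDenominator_le hG0.le hG h0' h1' (hv i))
      (gramsState_succ_w f η β₁ β₂ ε w₁ k) (momentHat_succ_sub h0 h1 k)
    rw [← hq, ← hΦ] at hstep
    have hk0 : (0 : ℝ) ≤ k := Nat.cast_nonneg k
    refine (mul_le_mul_of_nonneg_left hstep (by positivity)).trans (le_trans ?_ ih)
    rw [← mul_assoc]
    refine mul_le_mul_of_nonneg_right ?_ hΦ0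
    push_cast
    -- (1 + (k+1)q)(1 - q) = 1 + kq - (k+1)q².
    nlinarith [mul_nonneg hk0 (sq_nonneg q), sq_nonneg q]

end Iterates

/-! ### Choice of constants and conclusion -/

theorem mainTheorem1 (L ε : ℝ) (hL : 0 < L) (hε : 0 < ε) :
    -- `c ≤ C` are the constants in `1 - β₁ = Θ(η G ^ (1/2))`
    ∃ c : ℝ, 0 < c ∧ ∀ C : ℝ, c ≤ C → ∀ μ G : ℝ, 0 < μ →
      ∃ η₀ : ℝ, 0 < η₀ ∧
        ∀ (d : ℕ) (f : EuclideanSpace ℝ (Fin d) → ℝ),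
          BddBelow (Set.range f) → IsLSmooth L f → IsPL μ f →
          ∀ w₁ : EuclideanSpace ℝ (Fin d),
            max ε (3 * Real.sqrt (L * (f w₁ - ⨅ z, f z))) ≤ G →
            ∀ η β₁ β₂ : ℝ, 0 < η → η ≤ η₀ →
              0 ≤ β₁ → β₁ < 1 → 0 ≤ β₂ → β₂ < 1 →
              c * (η * Real.sqrt G) ≤ 1 - β₁ → 1 - β₁ ≤ C * (η * Real.sqrt G) →
              ∀ T : ℕ, 1 ≤ T →
                f (gramsWeight f η β₁ β₂ ε w₁ T) - (⨅ z, f z)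
                  ≤ 4 * G / (μ * η * T) * (f w₁ - ⨅ z, f z) := by
  -- As √G ≥ √ε, this `c` forces 1 - β₁ ≥ 8Lη/ε.
  refine ⟨8 * L / (ε * Real.sqrt ε), by positivity,
    fun C _ μ G hμ => ⟨ε / (8 * L), by positivity, ?_⟩⟩
  intro d f hb hf hPL w₁ hmax η β₁ β₂ hη hη₀ h0 h1 h0' h1' hc _ T hT
  have hG : ε ≤ G := (le_max_left _ _).trans hmax
  have hG0 : 0 < G := hε.trans_le hG
  have hΔ : ∀ x, 0 ≤ f x - ⨅ z, f z := fun x => sub_nonneg.2 (ciInf_le hb x)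
  have hηL : 8 * (L * η) ≤ ε := by
    rw [le_div_iff₀ (by positivity)] at hη₀
    linarith
  have hGΔ : 2 * L * (f w₁ - ⨅ z, f z) ≤ G ^ 2 := by
    have h2 := pow_le_pow_left₀ (by positivity) ((le_max_right _ _).trans hmax) 2
    rw [mul_pow, Real.sq_sqrt (mul_nonneg hL.le (hΔ w₁))] at h2
    nlinarith [mul_nonneg hL.le (hΔ w₁)]
  have hβ : 8 * L * η ≤ ε * (1 - β₁) := by
    have h2 : 8 * L / (ε * Real.sqrt ε) * (η * Real.sqrt ε) ≤ 1 - β₁ := le_trans (by gcongr) hc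
    have h3 : 8 * L / (ε * Real.sqrt ε) * (η * Real.sqrt ε) = 8 * L * η / ε := by
      have := (Real.sqrt_pos.2 hε).ne'
      field_simp
    rw [h3, div_le_iff₀ hε] at h2
    linarith
  by_cases hμL : μ ≤ L
  · obtain ⟨h2, -⟩ := grams_lyapunov_bound hL hμ hε hη hηL hf hb hPL hμL hG hGΔ h0 h1 h0' h1'
      hβ (T - 1)
    have hq0 : 0 < μ * η / (4 * G) := by positivity
    have hq1 : μ * η / (4 * G) ≤ 1 := by
      rw [div_le_one (by positivity)]
      have : μ * η ≤ L * η := by gcongr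
      linarith
    have hT0 : (0 : ℝ) < T := by exact_mod_cast hT
    rw [gramsWeight]
    set Δ := f (gramsState f η β₁ β₂ ε w₁ (T - 1)).w - ⨅ z, f z with hΔdef
    have hβ0 : 0 < 1 - β₁ := sub_pos.2 h1
    have h3 : T * (μ * η / (4 * G)) * Δ ≤ f w₁ - ⨅ z, f z := by
      refine le_trans ?_ h2
      rw [Nat.cast_sub hT]
      push_cast
      -- T - 1 updates suffice for a factor T, because q ≤ 1 gives Tq ≤ 1 + (T - 1)q.
      have h4 : (0 : ℝ) ≤ 1 + (T - 1) * (μ * η / (4 * G)) := by nlinarith [mul_pos hT0 hq0]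
      refine mul_le_mul (by linarith) (le_add_of_nonneg_right (by positivity)) (hΔ _) h4
    calc Δ = 4 * G / (μ * η * T) * (T * (μ * η / (4 * G)) * Δ) := by field_simp
      _ ≤ _ := by gcongr
  · -- if `L < μ`, then `f` is constant
    have hconst : ∀ x, f x - ⨅ z, f z = 0 := fun x => by
      have h2 := (hPL x).trans (hf.norm_gradient_sq_le hL hb x)
      have h3 := hΔ x
      push Not at hμL
      nlinarith
    rw [hconst, hconst, mul_zero]
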